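/- A \emph{quandle} is a set $Q$ with a binary operation $*$ such that, for all $x,y,z\in Q$: $x*(y*z)=(x*y)*(x*z)$; there is a unique $w\in Q$ with $x*w=z$; and $x*x=x$. Let $X_{Qdl}$ be the standard Borel space of all quandles with domain $\mathbb{N}$, that is, the Borel subset of $\mathbb{N}^{\mathbb{N}\times\mathbb{N}}$ (product of discrete spaces) consisting of the quandle operations on $\mathbb{N}$. For $q,r\in X_{Qdl}$ write $q\sqsubseteq_{Qdl} r$ if there is an injective map $f:\mathbb{N}\to\mathbb{N}$ with $f(x*_q y)=f(x)*_r f(y)$ for all $x,y$, and $q\cong_{Qdl} r$ if there is a bijective such map. A subset $A$ of a standard Borel space $X$ is \emph{analytic} if it is the projection to $X$ of a Borel subset of $X\times Z$ for some Polish space $Z$. A \emph{quasi-order} is a reflexive and transitive binary relation; a relation on $X$ is analytic if it is an analytic subset of $X\times X$. For relations $P$ on $X$ and $R$ on $Y$ ($X,Y$ standard Borel), $P$ is \emph{Borel reducible} to $R$ if there is a Borel function $f:X\to Y$ with $x\mathrel{P}x'\iff f(x)\mathrel{R}f(x')$ for all $x,x'\in X$; $P$ and $R$ are \emph{Borel bi-reducible}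 if each is Borel reducible to the other. \textbf{Theorem.} The relation $\sqsubseteq_{Qdl}$ of embeddability between quandles on $\mathbb{N}$ is an analytic quasi-order that is invariantly universal with respect to isomorphism. That is: $\sqsubseteq_{Qdl}$ is an analytic quasi-order on $X_{Qdl}$, $\cong_{Qdl}$ is an analytic equivalence relation contained in $\sqsubseteq_{Qdl}$, and for every analytic quasi-order $R$ on a standard Borel space there is a Borel set $B\subseteq X_{Qdl}$, invariant under $\cong_{Qdl}$, such that the restriction of $\sqsubseteq_{Qdl}$ to $B$ is Borel bi-reducible with $R$. -/

import Mathlib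

universe u v

/-! ### Analytic sets, analytic quasi-orders, Borel reducibility -/

/-- A subset `A` of a standard Borel space `X` is analytic if, for some Polish space `Z`, it is the
projection to `X` of a Borel subset of `X × Z`. -/
def IsAnalyticSubset {X : Type*} [MeasurableSpace X] (A : Set X) : Prop :=
  ∃ (Z : Type) (_ : TopologicalSpace Z) (_ : PolishSpace Z) (_ : MeasurableSpace Z)
    (_ : BorelSpace Z) (C : Set (X × Z)),
    MeasurableSet C ∧ A = {x | ∃ z, (x, z) ∈ C}

/-- A binary relation on a standard Borel space `X` is analytic if it is an analytic subset of
`X × X`. -/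
def IsAnalyticRel {X : Type*} [MeasurableSpace X] (R : X → X → Prop) : Prop :=
  IsAnalyticSubset {p : X × X | R p.1 p.2}

/-- An analytic quasi-order: an analytic, reflexive and transitive relation. -/
structure IsAnalyticQuasiOrder {X : Type*} [MeasurableSpace X] (R : X → X → Prop) : Prop where
  refl : ∀ x, R x x
  trans : ∀ x y z, R x y → R y z → R x z
  analytic : IsAnalyticRel R

/-- `P ≤_B R`: there is a Borel reduction of `P` to `R`. -/
def BorelReducible {X Y : Type*} [MeasurableSpace X] [MeasurableSpace Y]
    (P : X → X → Prop) (R : Y → Y → Prop) : Prop :=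
  ∃ f : X → Y, Measurable f ∧ ∀ x y, P x y ↔ R (f x) (f y)

/-- `P ∼_B R`: Borel bi-reducibility. -/
def BorelBireducible {X Y : Type*} [MeasurableSpace X] [MeasurableSpace Y]
    (P : X → X → Prop) (R : Y → Y → Prop) : Prop :=
  BorelReducible P R ∧ BorelReducible R P

/-- The restriction of a relation on `X` to a subset of `X`. -/
def restrictRel {X : Type*} (P : X → X → Prop) (B : Set X) : B → B → Prop :=
  fun x y => P x y

/-- `B` is invariant with respect to `E`. -/
def IsInvariantSet {X : Type*} (E : X → X → Prop) (B : Set X) : Prop :=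
  ∀ x y, E x y → x ∈ B → y ∈ B

/-- `(P, E)` is invariantly universal: `P` is an analytic quasi-order on the standard Borel
space `X`, `E` is an analytic equivalence relation contained in `P`, and every analytic quasi-order
`R` on a standard Borel space is Borel bi-reducible with the restriction of `P` to some
`E`-invariant Borel set. -/
structure IsInvariantlyUniversal {X : Type v} [MeasurableSpace X] [StandardBorelSpace X]
    (P E : X → X → Prop) : Prop where
  quasiOrder : IsAnalyticQuasiOrder P
  equivalence : Equivalence E
  analytic : IsAnalyticRel E
  subrelation : ∀ x y, E x y → P x y
  universal : ∀ (Y : Type u) [MeasurableSpace Y] [StandardBorelSpace Y] (R : Y → Y → Prop),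
    IsAnalyticQuasiOrder R →
      ∃ B : Set X, MeasurableSet B ∧ IsInvariantSet E B ∧ BorelBireducible (restrictRel P B) R

/-! ### The space of quandles with domain `ℕ` -/

/-- The quandle axioms for a binary operation. -/
structure IsQuandleOp {Q : Type*} (op : Q → Q → Q) : Prop where
  self_distrib : ∀ x y z, op x (op y z) = op (op x y) (op x z)
  existsUnique : ∀ x z, ∃! y, op x y = z
  idem : ∀ x, op x x = x

/-- These are exactly the operations of Mathlib's quandles. -/
theorem isQuandleOp_iff {Q : Type*} (op : Q → Q → Q) :
    IsQuandleOp op ↔ ∃ q : Quandle Q, ∀ x y, q.act x y = op x y := by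
  constructor
  · intro h
    choose inv hinv huniq using h.existsUnique
    exact ⟨{ act := op
             self_distrib := fun {x y z} => h.self_distrib x y z
             invAct := inv
             left_inv := fun x y => (huniq x (op x y) y rfl).symm
             right_inv := fun x y => hinv x y
             fix := fun {x} => h.idem x }, fun _ _ => rfl⟩
  · rintro ⟨q, hq⟩
    obtain rfl : q.act = op := funext fun x => funext fun y => hq x y
    exact ⟨fun x y z => q.self_distrib,
      fun x z => ⟨q.invAct x z, q.right_inv x z, fun y hy => by
        rw [← q.left_inv x y]; exact congrArg _ hy⟩,
      fun x => q.fix⟩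

/-- The quandle operations on `ℕ`, as a subset of `ℕ^(ℕ × ℕ)`. The latter carries the product
σ-algebra, which is the Borel σ-algebra of the topology generated by the clopen sets
`{op | op m n = k}`. -/
def quandleOps : Set (ℕ → ℕ → ℕ) := {op | IsQuandleOp op}

/-- The space of quandles with domain `ℕ`, with the subspace σ-algebra. -/
abbrev QuandleSpace : Type := ↥quandleOps

theorem measurable_eval_of_measurable {f g : (ℕ → ℕ → ℕ) → ℕ} (hf : Measurable f)
    (hg : Measurable g) : Measurable fun op : ℕ → ℕ → ℕ => op (f op) (g op) := by
  have h : Measurable fun p : (ℕ → ℕ → ℕ) × (ℕ × ℕ) => p.1 p.2.1 p.2.2 :=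
    measurable_from_prod_countable_left fun q =>
      (measurable_pi_apply q.2).comp (measurable_pi_apply q.1)
  exact h.comp (measurable_id.prodMk (hf.prodMk hg))

theorem measurableSet_quandleOps : MeasurableSet quandleOps := by
  have e : ∀ x y : ℕ, Measurable fun op : ℕ → ℕ → ℕ => op x y := fun x y =>
    measurable_eval_of_measurable measurable_const measurable_const
  have h : quandleOps =
      (⋂ x, ⋂ y, ⋂ z, {op | op x (op y z) = op (op x y) (op x z)}) ∩
        ((⋂ x, ⋂ z, ⋃ y, {op | op x y = z} ∩ ⋂ y', {op | op x y' = z → y' = y}) ∩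
          ⋂ x, {op | op x x = x}) := by
    ext op
    simp only [Set.mem_inter_iff, Set.mem_iInter, Set.mem_iUnion]
    exact ⟨fun h => ⟨h.1, h.2, h.3⟩, fun h => ⟨h.1, h.2.1, h.2.2⟩⟩
  rw [h]
  refine MeasurableSet.inter ?_ (MeasurableSet.inter ?_ ?_)
  · exact MeasurableSet.iInter fun x => MeasurableSet.iInter fun y => MeasurableSet.iInter fun z =>
      measurableSet_eq_fun (measurable_eval_of_measurable measurable_const (e y z))
        (measurable_eval_of_measurable (e x y) (e x z))
  · refine MeasurableSet.iInter fun x => MeasurableSet.iInter fun z => MeasurableSet.iUnion fun y =>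
      MeasurableSet.inter (measurableSet_eq_fun (e x y) measurable_const)
        (MeasurableSet.iInter fun y' => ?_)
    exact (measurableSet_eq_fun (e x y') measurable_const).imp (MeasurableSet.const _)
  · exact MeasurableSet.iInter fun x => measurableSet_eq_fun (e x x) measurable_const

instance instStandardBorelSpaceQuandleSpace : StandardBorelSpace QuandleSpace :=
  measurableSet_quandleOps.standardBorel

/-- Embeddability: some injective map preserves the operation. -/
def QuandleEmbeds (q r : QuandleSpace) : Prop :=
  ∃ f : ℕ → ℕ, Function.Injective f ∧ ∀ x y, f (q.1 x y) = r.1 (f x) (f y)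

/-- Isomorphism: some permutation of `ℕ` preserves the operation. -/
def QuandleIso (q r : QuandleSpace) : Prop :=
  ∃ g : Equiv.Perm ℕ, ∀ x y, g (q.1 x y) = r.1 (g x) (g y)

/-!
Every analytic quasi-order `R` on a standard Borel space `Y` is realised by quandles `Q x`, for
`x` in `Y`, which depend on `x` in a Borel way, embed into each other exactly as `R` prescribes, are
pairwise non-isomorphic, and have a common, explicitly known automorphism group.

*Normal form.* After a Borel injection of `Y` into the Cantor space, `R` is the projection of a
closed set `F`. For `z : ℕ → ℕ`, consider chains of at most `z 0` steps, each of which is, up to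
level `n`, either an equality or the projection of a point of `F` with last component bounded by
`z`. This relation `TreeRel F n z` depends on finitely many entries only, is monotone in `z`,
contains equality, and composing it for `z` and `z'` lands in that for `z + z'`. By compactness and
transitivity of `R`, two points are related if and only if some `z` works for all `n`
(`exists_forall_treeRel`, `eq_or_of_forall_approxChain`).

*Digraphs.* To `x` one attaches the tree of finite sequences of naturals, with the order of
siblings; a node `s` carries the label `k` if `TreeRel` holds, with bound `s`, between the `k`-th
element of a dense sequence and `x`. If `x` is related to `y` via `z`, then raising the entries of
each node by suitable amounts, at least those given by `z`, preserves labels; conversely, an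
embedding sends a suitable branch for `x` to a branch which witnesses that `x` is related to `y`
(`exists_mapDepth_nodeLabels`, `eq_or_of_code_embedding`). Two
devices are added. A node carries a label only if its last entry declares it, so that preservation
of labels in one direction suffices for an embedding of digraphs (`exists_code_embedding`). One
further label makes the tree determine `x`, and the order of siblings makes it rigid
(`eq_id_of_code_iso`).

*Quandles.* On the double cover of the vertex set of a digraph, let every point over `a` exchange
the two points over `b` if there is an edge from `a` to `b`. This is a quandle, and embeddings of
these quandles correspond to embeddings of the digraphs (`quandleEmbeds_codeQuandle_iff`). Since
the digraphs are rigid, the automorphisms of the quandles are precisely the flips of fibres.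

*Borel saturation.* The permutations that are monotone on every fibre form a Borel transversal of
the group of flips. Hence the set of isomorphic copies of the quandles `Q x` is the injective Borel
image of `Y` times this transversal. By the Lusin–Souslin theorem it is Borel, and recovering `x`
from a copy of `Q x` is a Borel map (`measurableEmbedding_conjCodeQuandle`).
-/

/-! ### A tree representation of transitive analytic relations on the Cantor space -/

/-- Two binary sequences agree on their first `n` entries. -/
def EqUpTo (n : ℕ) (x y : ℕ → Bool) : Prop := ∀ i < n, x i = y i

theorem EqUpTo.refl (n : ℕ) (x : ℕ → Bool) : EqUpTo n x x := fun _ _ => rfl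

theorem EqUpTo.symm {n : ℕ} {x y : ℕ → Bool} (h : EqUpTo n x y) : EqUpTo n y x :=
  fun i hi => (h i hi).symm

theorem EqUpTo.trans {n : ℕ} {x y z : ℕ → Bool} (h : EqUpTo n x y) (h' : EqUpTo n y z) :
    EqUpTo n x z := fun i hi => (h i hi).trans (h' i hi)

theorem EqUpTo.mono {m n : ℕ} (hmn : m ≤ n) {x y : ℕ → Bool} (h : EqUpTo n x y) :
    EqUpTo m x y := fun i hi => h i (hi.trans_le hmn)

theorem isOpen_eqUpTo (n : ℕ) (x : ℕ → Bool) : IsOpen {y | EqUpTo n x y} := by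
  have : {y | EqUpTo n x y} = ⋂ i ∈ Finset.range n, (fun y : ℕ → Bool => y i) ⁻¹' {x i} := by
    ext y
    simp [EqUpTo, eq_comm]
  rw [this]
  exact isOpen_biInter_finset fun i _ => (isOpen_discrete _).preimage (continuous_apply i)

theorem isOpen_of_eqUpTo {n : ℕ} {s : Set (ℕ → Bool)}
    (h : ∀ x y, EqUpTo n x y → x ∈ s → y ∈ s) : IsOpen s :=
  isOpen_iff_mem_nhds.2 fun x hx =>
    Filter.mem_of_superset ((isOpen_eqUpTo n x).mem_nhds (EqUpTo.refl n x)) fun y hy => h x y hy hx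

theorem isClosed_of_eqUpTo {n : ℕ} {s : Set (ℕ → Bool)}
    (h : ∀ x y, EqUpTo n x y → x ∈ s → y ∈ s) : IsClosed s :=
  ⟨isOpen_of_eqUpTo fun x y hxy hx hy => hx (h y x hxy.symm hy)⟩

theorem exists_denseSeq_eqUpTo (n : ℕ) (x : ℕ → Bool) :
    ∃ j, EqUpTo n x (TopologicalSpace.denseSeq (ℕ → Bool) j) :=
  (TopologicalSpace.denseRange_denseSeq (ℕ → Bool)).exists_mem_open (isOpen_eqUpTo n x)
    ⟨x, EqUpTo.refl n x⟩

/-- The `n`-th approximation, with bound `z`, of one step of the projection of `F`: up to equality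
of the first `n` entries, either `x = y`, or `(x, y)` is the projection of a point of `F` whose
last component is below `z` on its first `n` entries. -/
def ApproxStep (F : Set (((ℕ → Bool) × (ℕ → Bool)) × (ℕ → ℕ))) (n : ℕ) (z : ℕ → ℕ)
    (x y : ℕ → Bool) : Prop :=
  EqUpTo n x y ∨ ∃ p ∈ F, EqUpTo n p.1.1 x ∧ EqUpTo n p.1.2 y ∧ ∀ i < n, p.2 i ≤ z i

/-- Chains of `k` approximate steps. -/
def ApproxChain (F : Set (((ℕ → Bool) × (ℕ → Bool)) × (ℕ → ℕ))) (n : ℕ) (z : ℕ → ℕ) :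
    ℕ → (ℕ → Bool) → (ℕ → Bool) → Prop
  | 0, x, y => EqUpTo n x y
  | k + 1, x, y => ∃ w, ApproxChain F n z k x w ∧ ApproxStep F n z w y

section Approx

variable {F : Set (((ℕ → Bool) × (ℕ → Bool)) × (ℕ → ℕ))}

theorem ApproxStep.congr {n : ℕ} {z : ℕ → ℕ} {x x' y y' : ℕ → Bool} (h : ApproxStep F n z x y)
    (hx : EqUpTo n x x') (hy : EqUpTo n y y') : ApproxStep F n z x' y' := by
  rcases h with h | ⟨p, hp, h1, h2, h3⟩
  · exact Or.inl (hx.symm.trans (h.trans hy))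
  · exact Or.inr ⟨p, hp, h1.trans hx, h2.trans hy, h3⟩

theorem ApproxStep.mono {m n : ℕ} (hmn : m ≤ n) {z z' : ℕ → ℕ} (hz : ∀ i < m, z i ≤ z' i)
    {x y : ℕ → Bool} (h : ApproxStep F n z x y) : ApproxStep F m z' x y := by
  rcases h with h | ⟨p, hp, h1, h2, h3⟩
  · exact Or.inl (h.mono hmn)
  · exact Or.inr ⟨p, hp, h1.mono hmn, h2.mono hmn,
      fun i hi => (h3 i (hi.trans_le hmn)).trans (hz i hi)⟩

theorem ApproxChain.congr_right {n : ℕ} {z : ℕ → ℕ} {k : ℕ} {x y y' : ℕ → Bool}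
    (h : ApproxChain F n z k x y) (hy : EqUpTo n y y') : ApproxChain F n z k x y' := by
  cases k with
  | zero => exact EqUpTo.trans h hy
  | succ k =>
    obtain ⟨w, h1, h2⟩ := h
    exact ⟨w, h1, h2.congr (EqUpTo.refl n w) hy⟩

theorem ApproxChain.congr_left {n : ℕ} {z : ℕ → ℕ} {k : ℕ} {x x' y : ℕ → Bool}
    (h : ApproxChain F n z k x y) (hx : EqUpTo n x x') : ApproxChain F n z k x' y := by
  induction k generalizing y with
  | zero => exact hx.symm.trans h
  | succ k ih =>
    obtain ⟨w, h1, h2⟩ := h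
    exact ⟨w, ih h1, h2⟩

theorem ApproxChain.mono {m n : ℕ} (hmn : m ≤ n) {z z' : ℕ → ℕ} (hz : ∀ i < m, z i ≤ z' i)
    {k : ℕ} {x y : ℕ → Bool} (h : ApproxChain F n z k x y) : ApproxChain F m z' k x y := by
  induction k generalizing y with
  | zero => exact EqUpTo.mono hmn h
  | succ k ih =>
    obtain ⟨w, h1, h2⟩ := h
    exact ⟨w, ih h1, h2.mono hmn hz⟩

theorem ApproxChain.mono_length {n : ℕ} {z : ℕ → ℕ} {k l : ℕ} (hkl : k ≤ l) {x y : ℕ → Bool}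
    (h : ApproxChain F n z k x y) : ApproxChain F n z l x y := by
  induction l, hkl using Nat.le_induction with
  | base => exact h
  | succ l _ ih => exact ⟨y, ih, Or.inl (EqUpTo.refl n y)⟩

theorem ApproxChain.trans {n : ℕ} {z : ℕ → ℕ} {k l : ℕ} {x y w : ℕ → Bool}
    (h : ApproxChain F n z k x y) (h' : ApproxChain F n z l y w) :
    ApproxChain F n z (k + l) x w := by
  induction l generalizing w with
  | zero => exact h.congr_right h'
  | succ l ih =>
    obtain ⟨v, h1, h2⟩ := h'
    exact ⟨v, ih h1, h2⟩

/-- An approximate step that survives at every level is an actual step. The witnesses have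
bounded coordinates: for almost all `n` the `i`-th coordinate is at most `z i`. -/
theorem eq_or_exists_of_forall_approxStep (hF : IsClosed F) {z : ℕ → ℕ} {x y : ℕ → Bool}
    (h : ∀ n, ApproxStep F n z x y) : x = y ∨ ∃ t, ((x, y), t) ∈ F := by
  by_cases hxy : x = y
  · exact Or.inl hxy
  right
  obtain ⟨m, hm⟩ : ∃ m, x m ≠ y m := Function.ne_iff.1 hxy
  have h' : ∀ n, ∃ p ∈ F, EqUpTo n p.1.1 x ∧ EqUpTo n p.1.2 y ∧ ∀ i < n, p.2 i ≤ z i := by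
    intro n
    have h0 := h (max n (m + 1))
    rcases h0 with h0 | ⟨p, hp, h1, h2, h3⟩
    · exact absurd (h0 m (by omega)) hm
    · exact ⟨p, hp, h1.mono (le_max_left _ _), h2.mono (le_max_left _ _),
        fun i hi => h3 i (by omega)⟩
  choose p hpF hp1 hp2 hp3 using h'
  let b : ℕ → ℕ := fun i => z i + ∑ n ∈ Finset.range (i + 1), (p n).2 i
  have hb : ∀ n, (p n).2 ∈ Set.Icc (0 : ℕ → ℕ) b := by
    refine fun n => ⟨fun i => Nat.zero_le _, fun i => ?_⟩
    rcases lt_or_ge i n with hi | hi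
    · exact (hp3 n i hi).trans (Nat.le_add_right _ _)
    · exact (Finset.single_le_sum (f := fun n => (p n).2 i) (fun _ _ => Nat.zero_le _)
        (Finset.mem_range.2 (Nat.lt_succ_of_le hi))).trans (Nat.le_add_left _ _)
  obtain ⟨t, -, φ, hφ, ht⟩ := (isCompact_Icc (a := (0 : ℕ → ℕ)) (b := b)).tendsto_subseq hb
  have lim : ∀ (u : ℕ → ℕ → Bool) (v : ℕ → Bool), (∀ n, EqUpTo n (u n) v) →
      Filter.Tendsto (fun n => u (φ n)) Filter.atTop (nhds v) := by
    intro u v huv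
    rw [tendsto_pi_nhds]
    intro i
    refine tendsto_const_nhds.congr' ?_
    filter_upwards [Filter.eventually_gt_atTop i] with n hn
    exact (huv _ i (hn.trans_le hφ.le_apply)).symm
  exact ⟨t, hF.mem_of_tendsto (((lim _ x hp1).prodMk_nhds (lim _ y hp2)).prodMk_nhds ht)
    (Filter.Eventually.of_forall fun n => hpF (φ n))⟩

/-- By compactness of the Cantor space, chains of a fixed length that exist at every level of
approximation yield an actual chain. -/
theorem eq_or_of_forall_approxChain (hF : IsClosed F) {A : (ℕ → Bool) → (ℕ → Bool) → Prop}
    (hA : ∀ x y, A x y ↔ ∃ t, ((x, y), t) ∈ F) (htrans : ∀ x y w, A x y → A y w → A x w)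
    {z : ℕ → ℕ} {k : ℕ} {x y : ℕ → Bool} (h : ∀ n, ApproxChain F n z k x y) :
    x = y ∨ A x y := by
  induction k generalizing y with
  | zero => exact Or.inl (funext fun i => h (i + 1) i (Nat.lt_succ_self i))
  | succ k ih =>
    let K : ℕ → Set (ℕ → Bool) := fun n => {w | ApproxChain F n z k x w ∧ ApproxStep F n z w y}
    have hK : ∀ n, IsClosed (K n) := fun n => isClosed_of_eqUpTo (n := n) fun w w' hw hwK =>
      ⟨hwK.1.congr_right hw, hwK.2.congr hw (EqUpTo.refl n y)⟩
    obtain ⟨w, hw⟩ := IsCompact.nonempty_iInter_of_sequence_nonempty_isCompact_isClosed K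
      (fun n w hw => ⟨hw.1.mono n.le_succ fun _ _ => le_rfl, hw.2.mono n.le_succ fun _ _ => le_rfl⟩)
      h (hK 0).isCompact hK
    rw [Set.mem_iInter] at hw
    have h1 := ih fun n => (hw n).1
    have h2 := eq_or_exists_of_forall_approxStep hF fun n => (hw n).2
    rw [← hA] at h2
    rcases h1 with rfl | h1
    · exact h2
    · rcases h2 with rfl | h2
      · exact Or.inr h1
      · exact Or.inr (htrans _ _ _ h1 h2)

/-- The normal form of a transitive analytic relation: `(x, y)` is related, or `x = y`, if and only
if for some `z` the relation `TreeRel F n z x y` holds for all `n`. The entry `z 0` bounds the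
length of a chain of approximate steps, and all entries bound the witnesses. -/
def TreeRel (F : Set (((ℕ → Bool) × (ℕ → Bool)) × (ℕ → ℕ))) (n : ℕ) (z : ℕ → ℕ)
    (x y : ℕ → Bool) : Prop :=
  ApproxChain F n z (z 0) x y

theorem TreeRel.of_eqUpTo {n : ℕ} (z : ℕ → ℕ) {x y : ℕ → Bool} (h : EqUpTo n x y) :
    TreeRel F n z x y :=
  ApproxChain.mono_length (k := 0) (Nat.zero_le _) h

theorem TreeRel.mono {n : ℕ} (hn : 0 < n) {z z' : ℕ → ℕ} (hz : ∀ i < n, z i ≤ z' i)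
    {x y : ℕ → Bool} (h : TreeRel F n z x y) : TreeRel F n z' x y :=
  (ApproxChain.mono le_rfl hz h).mono_length (hz 0 hn)

theorem TreeRel.trans {n : ℕ} {z z' : ℕ → ℕ} {x y w : ℕ → Bool}
    (h : TreeRel F n z x y) (h' : TreeRel F n z' y w) : TreeRel F n (z + z') x w :=
  (ApproxChain.mono le_rfl (fun i _ => Nat.le_add_right (z i) (z' i)) h).trans
    (ApproxChain.mono le_rfl (fun i _ => Nat.le_add_left (z' i) (z i)) h')

theorem exists_forall_treeRel {x y : ℕ → Bool} (h : x = y ∨ ∃ t, ((x, y), t) ∈ F) :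
    ∃ z, ∀ n, TreeRel F n z x y := by
  rcases h with rfl | ⟨t, ht⟩
  · exact ⟨0, fun n => TreeRel.of_eqUpTo _ (EqUpTo.refl n x)⟩
  · -- the summand `1` makes room for a chain of length one
    refine ⟨t + 1, fun n => ApproxChain.mono_length (k := 1) (by simp) ?_⟩
    exact ⟨x, EqUpTo.refl n x, Or.inr ⟨_, ht, EqUpTo.refl n x, EqUpTo.refl n y,
      fun i _ => Nat.le_succ _⟩⟩

end Approx

/-- The finite sequence coded by a list, read from the end of the list and extended by zeros. Lists
are thus regarded as nodes of a tree in which `a :: L` is a child of `L`. -/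
def listSeq (L : List ℕ) (i : ℕ) : ℕ := L.reverse.getD i 0

theorem listSeq_cons_of_lt {L : List ℕ} {i : ℕ} (a : ℕ) (hi : i < L.length) :
    listSeq (a :: L) i = listSeq L i := by
  rw [listSeq, listSeq, List.reverse_cons, List.getD_append _ _ _ _ (by simpa using hi)]

theorem listSeq_cons_length (a : ℕ) (L : List ℕ) : listSeq (a :: L) L.length = a := by
  simp [listSeq]

/-- Apply `p i` to the entry at depth `i`. -/
def mapDepth (p : ℕ → ℕ → ℕ) : List ℕ → List ℕ
  | [] => []
  | a :: L => p L.length a :: mapDepth p L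

theorem length_mapDepth (p : ℕ → ℕ → ℕ) (L : List ℕ) : (mapDepth p L).length = L.length := by
  induction L with
  | nil => rfl
  | cons a L ih => simp [mapDepth, ih]

theorem listSeq_mapDepth (p : ℕ → ℕ → ℕ) (L : List ℕ) {i : ℕ} (hi : i < L.length) :
    listSeq (mapDepth p L) i = p i (listSeq L i) := by
  induction L with
  | nil => simp at hi
  | cons a L ih =>
    rcases Nat.lt_succ_iff_lt_or_eq.1 hi with h | rfl
    · rw [mapDepth, listSeq_cons_of_lt _ (by rwa [length_mapDepth]), listSeq_cons_of_lt _ h, ih h]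
    · have := listSeq_cons_length (p L.length a) (mapDepth p L)
      rw [length_mapDepth] at this
      rw [mapDepth, this, listSeq_cons_length]

/-- The set of labelled nodes attached to `x`. A node `a :: L` carries the label `0` if `a` codes a
pair `(n, x n)`; these labels determine `x`. It carries the label `k + 1` if the tree relation holds
between the `k`-th element of a dense sequence and `x`. -/
def nodeLabels (F : Set (((ℕ → Bool) × (ℕ → Bool)) × (ℕ → ℕ))) (x : ℕ → Bool) :
    ℕ → List ℕ → Prop
  | 0, L => x (L.headI / 2) = decide (L.headI % 2 = 1)
  | k + 1, L => TreeRel F L.length (listSeq L) (TopologicalSpace.denseSeq (ℕ → Bool) k) x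

theorem isOpen_nodeLabels (F : Set (((ℕ → Bool) × (ℕ → Bool)) × (ℕ → ℕ))) (k : ℕ) (L : List ℕ) :
    IsOpen {x | nodeLabels F x k L} := by
  cases k with
  | zero =>
    refine isOpen_of_eqUpTo (n := L.headI / 2 + 1) fun x y hxy hx => ?_
    exact (hxy _ (Nat.lt_succ_self _)).symm.trans hx
  | succ k => exact isOpen_of_eqUpTo (n := L.length) fun x y hxy hx => ApproxChain.congr_right hx hxy

/-- The labels of the nodes at depth one determine the sequence. -/
theorem eq_of_nodeLabels {F : Set (((ℕ → Bool) × (ℕ → Bool)) × (ℕ → ℕ))} {x y : ℕ → Bool}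
    (h : ∀ a, nodeLabels F x 0 [a] ↔ nodeLabels F y 0 [a]) : x = y := by
  funext n
  have h1 := h (2 * n + 1)
  have e1 : (2 * n + 1) / 2 = n := by omega
  have e2 : (2 * n + 1) % 2 = 1 := by omega
  simp only [nodeLabels, List.headI, e1, e2, decide_true] at h1
  exact Bool.eq_iff_iff.2 h1

/-- If `x` and `y` are related, a level-preserving map of the tree transports labels. -/
theorem exists_mapDepth_nodeLabels {F : Set (((ℕ → Bool) × (ℕ → Bool)) × (ℕ → ℕ))}
    {x y : ℕ → Bool} (h : x = y ∨ ∃ t, ((x, y), t) ∈ F) :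
    ∃ p : ℕ → ℕ → ℕ, ∀ k a L,
      nodeLabels F x k (a :: L) → nodeLabels F y k (mapDepth p (a :: L)) := by
  obtain ⟨z, hz⟩ := exists_forall_treeRel h
  -- every value of `p` codes a pair `(m, y m)`, so the label `0` is always present in the image
  refine ⟨fun i v => 2 * (v + z i) + (y (v + z i)).toNat, fun k a L hk => ?_⟩
  cases k with
  | zero =>
    have key : ∀ m, y ((2 * m + (y m).toNat) / 2) =
        decide ((2 * m + (y m).toNat) % 2 = 1) := fun m => by
      cases hm : y m
      · simp [hm]
      · have e1 : (2 * m + 1) / 2 = m := by omega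
        have e2 : (2 * m + 1) % 2 = 1 := by omega
        simp [hm, e1, e2]
    exact key _
  | succ k =>
    simp only [nodeLabels, length_mapDepth]
    refine TreeRel.mono (by simp) (fun i hi => ?_) (TreeRel.trans hk (hz _))
    rw [listSeq_mapDepth _ _ hi, Pi.add_apply]
    omega

/-- Conversely, `x` and `y` are related as soon as, along some branch `z`, the node at each level
`n > 0` carries for `y` the label of a member of the dense sequence that agrees with `x` up to
`n`. -/
theorem eq_or_of_nodeLabels {F : Set (((ℕ → Bool) × (ℕ → Bool)) × (ℕ → ℕ))} (hF : IsClosed F)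
    {A : (ℕ → Bool) → (ℕ → Bool) → Prop} (hA : ∀ x y, A x y ↔ ∃ t, ((x, y), t) ∈ F)
    (htrans : ∀ x y w, A x y → A y w → A x w) {x y : ℕ → Bool} {z : ℕ → ℕ} {L : ℕ → List ℕ}
    (hL0 : L 0 = []) (hL : ∀ n, L (n + 1) = z n :: L n) {j : ℕ → ℕ}
    (hj : ∀ n, EqUpTo n x (TopologicalSpace.denseSeq (ℕ → Bool) (j n)))
    (h : ∀ n, nodeLabels F y (j (n + 1) + 1) (L (n + 1))) : x = y ∨ A x y := by
  have hlen : ∀ n, (L n).length = n := fun n => by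
    induction n with
    | zero => simp [hL0]
    | succ n ih => simp [hL, ih]
  have hseq : ∀ n, ∀ i < n, listSeq (L n) i = z i := fun n => by
    induction n with
    | zero => intro i hi; omega
    | succ n ih =>
      intro i hi
      rw [hL]
      rcases Nat.lt_succ_iff_lt_or_eq.1 hi with hi | rfl
      · rw [listSeq_cons_of_lt _ (by rwa [hlen]), ih i hi]
      · have h0 := listSeq_cons_length (z i) (L i)
        rwa [hlen] at h0
  refine eq_or_of_forall_approxChain hF hA htrans (z := z) (k := z 0) fun n => ?_
  have h1 := h n
  rw [nodeLabels, hlen] at h1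
  have h2 : TreeRel F (n + 1) z _ y :=
    TreeRel.mono n.succ_pos (fun i hi => (hseq _ i hi).le) h1
  exact ApproxChain.mono n.le_succ (fun _ _ => le_rfl) (ApproxChain.congr_left h2 (hj _).symm)

/-! ### Digraphs coding labelled trees -/

/-- The value of a node entry. -/
def entryValue (i : ℕ) : ℕ := (Nat.unpair (Nat.unpair i).1).1

/-- The label declared by a node entry, shifted by one; `0` stands for no declaration. -/
def entryLabel (i : ℕ) : ℕ := (Nat.unpair (Nat.unpair i).1).2

theorem frequently_entry (v l : ℕ) :
    ∃ᶠ i in Filter.atTop, entryValue i = v ∧ entryLabel i = l := by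
  refine Filter.frequently_atTop.2 fun N => ⟨Nat.pair (Nat.pair v l) N, Nat.right_le_pair _ _, ?_⟩
  simp [entryValue, entryLabel]

/-- Edges between nodes: a node points to its parent and to its siblings with larger last entry. -/
inductive NodeEdge : List ℕ → List ℕ → Prop
  | parent (i : ℕ) (s : List ℕ) : NodeEdge (i :: s) s
  | sibling {i j : ℕ} (s : List ℕ) (hij : i < j) : NodeEdge (i :: s) (j :: s)

/-- The node `s` carries the label `k` with respect to `S`: this is declared by its last entry, and
the pair of `k` and the list of values of `s` belongs to `S`. -/
inductive HasLabel (S : ℕ → List ℕ → Prop) : ℕ → List ℕ → Prop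
  | mk {k i : ℕ} (s : List ℕ) (hi : entryLabel i = k + 1) (hS : S k ((i :: s).map entryValue)) :
      HasLabel S k (i :: s)

/-- The vertices of the coding digraphs: two base points, a label vertex for each natural number,
and the nodes of the tree of finite sequences. -/
abbrev CodeVertex : Type := ℕ ⊕ List ℕ

/-- The first base point. -/
abbrev basePt : CodeVertex := Sum.inl 0

/-- The second base point, which points to all other vertices. -/
abbrev sourcePt : CodeVertex := Sum.inl 1

/-- The vertex of the label `k`. -/
abbrev labelPt (k : ℕ) : CodeVertex := Sum.inl (k + 2)

/-- The vertex of the node `s`. -/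
abbrev nodePt (s : List ℕ) : CodeVertex := Sum.inr s

/-- The digraph coding the set `S` of labelled lists. The base points form its only `2`-cycle, the
label vertices form an infinite path into the first base point, and every label vertex points to
the nodes which carry that label. -/
inductive CodeEdge (S : ℕ → List ℕ → Prop) : CodeVertex → CodeVertex → Prop
  | base_source : CodeEdge S basePt sourcePt
  | source_base : CodeEdge S sourcePt basePt
  | source_label (k : ℕ) : CodeEdge S sourcePt (labelPt k)
  | source_node (s : List ℕ) : CodeEdge S sourcePt (nodePt s)
  | base_node : CodeEdge S basePt (nodePt [])
  | label_base : CodeEdge S (labelPt 0) basePt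
  | label_label (k : ℕ) : CodeEdge S (labelPt (k + 1)) (labelPt k)
  | node_node {s t : List ℕ} (h : NodeEdge s t) : CodeEdge S (nodePt s) (nodePt t)
  | label_node {k : ℕ} {s : List ℕ} (h : HasLabel S k s) : CodeEdge S (labelPt k) (nodePt s)

/-- Digraph embeddings: injections which preserve edges and non-edges. -/
structure IsDigraphEmbedding {V W : Type*} (E : V → V → Prop) (E' : W → W → Prop) (f : V → W) :
    Prop where
  injective : Function.Injective f
  map_iff : ∀ a b, E a b ↔ E' (f a) (f b)

section Code

variable {S S' : ℕ → List ℕ → Prop}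

theorem nodeEdge_cons_cons {i j : ℕ} {s t : List ℕ} :
    NodeEdge (i :: s) (j :: t) ↔ s = j :: t ∨ (s = t ∧ i < j) := by
  constructor
  · intro h
    cases h with
    | parent => exact Or.inl rfl
    | sibling _ h => exact Or.inr ⟨rfl, h⟩
  · rintro (rfl | ⟨rfl, h⟩)
    · exact .parent i _
    · exact .sibling _ h

theorem exists_codeEdge (b : CodeVertex) : ∃ a, CodeEdge S a b := by
  rcases b with (_ | _ | k) | s
  · exact ⟨_, .source_base⟩
  · exact ⟨_, .base_source⟩
  · exact ⟨_, .source_label k⟩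
  · exact ⟨_, .source_node s⟩

theorem NodeEdge.length_le {s t : List ℕ} (h : NodeEdge s t) :
    t.length ≤ s.length ∧ s.length ≤ t.length + 1 := by
  cases h <;> simp

theorem codeEdge_base_iff {a : CodeVertex} :
    CodeEdge S a basePt ↔ a = sourcePt ∨ a = labelPt 0 := by
  refine ⟨fun h => ?_, ?_⟩
  · cases h
    · exact Or.inl rfl
    · exact Or.inr rfl
  · rintro (rfl | rfl)
    · exact .source_base
    · exact .label_base

theorem codeEdge_of_base_iff {a : CodeVertex} :
    CodeEdge S basePt a ↔ a = sourcePt ∨ a = nodePt [] := by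
  refine ⟨fun h => ?_, ?_⟩
  · cases h
    · exact Or.inl rfl
    · exact Or.inr rfl
  · rintro (rfl | rfl)
    · exact .base_source
    · exact .base_node

theorem codeEdge_label_iff {a : CodeVertex} {k : ℕ} :
    CodeEdge S a (labelPt k) ↔ a = sourcePt ∨ a = labelPt (k + 1) := by
  refine ⟨fun h => ?_, ?_⟩
  · cases h
    · exact Or.inl rfl
    · exact Or.inr rfl
  · rintro (rfl | rfl)
    · exact .source_label k
    · exact .label_label k

theorem codeEdge_node_node_iff {s t : List ℕ} :
    CodeEdge S (nodePt s) (nodePt t) ↔ NodeEdge s t := by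
  refine ⟨fun h => ?_, .node_node⟩
  cases h
  assumption

theorem codeEdge_label_node_iff {k : ℕ} {s : List ℕ} :
    CodeEdge S (labelPt k) (nodePt s) ↔ HasLabel S k s := by
  refine ⟨fun h => ?_, .label_node⟩
  cases h
  assumption

/-- The base points form the only `2`-cycle. -/
theorem codeEdge_two_cycle {a b : CodeVertex} (h : CodeEdge S a b) (h' : CodeEdge S b a) :
    (a = basePt ∧ b = sourcePt) ∨ (a = sourcePt ∧ b = basePt) := by
  cases h with
  | base_source => exact Or.inl ⟨rfl, rfl⟩
  | source_base => exact Or.inr ⟨rfl, rfl⟩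
  | source_label k => cases h'
  | source_node s => cases h'
  | base_node => cases h'
  | label_base => cases h'
  | label_label k =>
    rcases codeEdge_label_iff.1 h' with h' | h' <;> simp at h'
  | node_node h =>
    exfalso
    rw [codeEdge_node_node_iff] at h'
    cases h with
    | parent i s => exact absurd h'.length_le.1 (by simp)
    | sibling s hij =>
      rcases nodeEdge_cons_cons.1 h' with h' | ⟨-, h'⟩
      · have := congrArg List.length h'
        simp at this
      · omega
  | label_node h => cases h'

theorem codeEdge_irrefl (a : CodeVertex) : ¬ CodeEdge S a a := by
  intro h
  rcases codeEdge_two_cycle h h with ⟨rfl, h⟩ | ⟨rfl, h⟩ <;> simp at h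

namespace IsDigraphEmbedding

variable {f : CodeVertex → CodeVertex}

theorem map_base_source (hf : IsDigraphEmbedding (CodeEdge S) (CodeEdge S') f) :
    f basePt = basePt ∧ f sourcePt = sourcePt := by
  rcases codeEdge_two_cycle ((hf.map_iff _ _).1 .base_source) ((hf.map_iff _ _).1 .source_base)
    with h | ⟨h0, h1⟩
  · exact h
  · -- if the base points were swapped, the first one would need three out-neighbours
    exfalso
    have key : ∀ k, f (labelPt k) = nodePt [] := fun k => by
      have h := (hf.map_iff _ _).1 (.source_label k)
      rw [h1, codeEdge_of_base_iff] at h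
      rcases h with h | h
      · exact absurd (hf.injective (h.trans h0.symm)) (by simp)
      · exact h
    exact absurd (hf.injective ((key 0).trans (key 1).symm)) (by simp)

theorem map_label (hf : IsDigraphEmbedding (CodeEdge S) (CodeEdge S') f) (k : ℕ) :
    f (labelPt k) = labelPt k := by
  obtain ⟨h0, h1⟩ := hf.map_base_source
  have hne : f (labelPt k) ≠ sourcePt := fun h => by
    have := hf.injective (h.trans h1.symm)
    simp at this
  induction k with
  | zero =>
    have h := (hf.map_iff _ _).1 .label_base
    rw [h0, codeEdge_base_iff] at h
    exact h.resolve_left hne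
  | succ k ih =>
    have h := (hf.map_iff _ _).1 (.label_label k)
    rw [ih fun h => by simpa using hf.injective (h.trans h1.symm), codeEdge_label_iff] at h
    exact h.resolve_left hne

theorem exists_map_node (hf : IsDigraphEmbedding (CodeEdge S) (CodeEdge S') f) (s : List ℕ) :
    ∃ t, f (nodePt s) = nodePt t ∧
      ∀ i u, s = i :: u → ∃ j v, t = j :: v ∧ f (nodePt u) = nodePt v := by
  obtain ⟨h0, h1⟩ := hf.map_base_source
  induction s with
  | nil =>
    have h := (hf.map_iff _ _).1 .base_node
    rw [h0, codeEdge_of_base_iff] at h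
    refine ⟨[], h.resolve_left fun h => ?_, fun i u h => by simp at h⟩
    have := hf.injective (h.trans h1.symm)
    simp at this
  | cons i s ih =>
    obtain ⟨t, ht, ht'⟩ := ih
    have h := (hf.map_iff _ _).1 (.node_node (.parent i s))
    rw [ht] at h
    have hne : ∀ m, f (nodePt (i :: s)) ≠ Sum.inl m := fun m hm => by
      have : ∃ a : ℕ, f (Sum.inl a) = Sum.inl m := by
        rcases m with _ | _ | k
        · exact ⟨0, h0⟩
        · exact ⟨1, h1⟩
        · exact ⟨k + 2, hf.map_label k⟩
      obtain ⟨a, ha⟩ := this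
      have := hf.injective (hm.trans ha.symm)
      simp at this
    rcases hw : f (nodePt (i :: s)) with m | w
    · exact absurd hw (hne m)
    rw [hw, codeEdge_node_node_iff] at h
    refine ⟨w, rfl, ?_⟩
    rintro i' u hu
    obtain ⟨rfl, rfl⟩ := List.cons.inj hu
    cases h with
    | parent j v => exact ⟨j, t, rfl, ht⟩
    | @sibling j j' v hj =>
      -- a sibling of the image of `s` points to the image of the parent of `s`
      exfalso
      rcases s with _ | ⟨i₀, s₀⟩
      · have := (hf.map_iff _ _).1 (.base_node)
        rw [ht, h0] at this
        rcases codeEdge_of_base_iff.1 this with h | h <;> simp at h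
      · obtain ⟨j₁, v₁, h2, h3⟩ := ht' i₀ s₀ rfl
        obtain ⟨rfl, rfl⟩ := List.cons.inj h2
        have h4 : CodeEdge S' (f (nodePt (i :: i₀ :: s₀))) (f (nodePt s₀)) := by
          rw [hw, h3]
          exact .node_node (.parent _ _)
        rw [← hf.map_iff, codeEdge_node_node_iff] at h4
        exact absurd h4.length_le.2 (by simp)

/-- A digraph embedding induces a map of nodes which preserves the parent relation, the order of
siblings and the labels. -/
theorem exists_node_map (hf : IsDigraphEmbedding (CodeEdge S) (CodeEdge S') f) :
    ∃ φ : List ℕ → List ℕ, (∀ s, f (nodePt s) = nodePt (φ s)) ∧ φ [] = [] ∧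
      (∀ s, ∃ g : ℕ → ℕ, StrictMono g ∧ ∀ i, φ (i :: s) = g i :: φ s) ∧
      ∀ k s, HasLabel S k s ↔ HasLabel S' k (φ s) := by
  choose φ hφ hφ' using hf.exists_map_node
  refine ⟨φ, hφ, ?_, fun s => ?_, fun k s => ?_⟩
  · have h := (hf.map_iff _ _).1 .base_node
    rw [hφ, hf.map_base_source.1, codeEdge_of_base_iff] at h
    simpa using h
  · have h1 : ∀ i, ∃ j, φ (i :: s) = j :: φ s := fun i => by
      obtain ⟨j, v, h1, h2⟩ := hφ' (i :: s) i s rfl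
      rw [hφ] at h2
      exact ⟨j, by rw [h1, Sum.inr_injective h2]⟩
    choose g hg using h1
    refine ⟨g, fun i j hij => ?_, hg⟩
    have h := (hf.map_iff _ _).1 (.node_node (.sibling s hij))
    rw [hφ, hφ, hg, hg, codeEdge_node_node_iff, nodeEdge_cons_cons] at h
    rcases h with h | h
    · have := congrArg List.length h
      simp at this
    · exact h.2
  · rw [← codeEdge_label_node_iff (S := S), ← codeEdge_label_node_iff (S := S'), hf.map_iff,
      hf.map_label, hφ]

end IsDigraphEmbedding

theorem hasLabel_cons {k i : ℕ} {s : List ℕ} :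
    HasLabel S k (i :: s) ↔ entryLabel i = k + 1 ∧ S k ((i :: s).map entryValue) :=
  ⟨fun h => by cases h; exact ⟨by assumption, by assumption⟩, fun h => .mk s h.1 h.2⟩

/-- Isomorphic coding digraphs come from the same labelled nodes, and the isomorphism is the
identity: a strictly monotone bijection of the siblings of each node is trivial. -/
theorem eq_id_of_code_iso {f f' : CodeVertex → CodeVertex}
    (hf : IsDigraphEmbedding (CodeEdge S) (CodeEdge S') f)
    (hf' : IsDigraphEmbedding (CodeEdge S') (CodeEdge S) f') (hff' : ∀ a, f' (f a) = a) :
    (∀ a, f a = a) ∧ ∀ k v L, S k (v :: L) ↔ S' k (v :: L) := by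
  obtain ⟨φ, hφ, hφ0, hφc, hφl⟩ := hf.exists_node_map
  obtain ⟨ψ, hψ, hψ0, hψc, -⟩ := hf'.exists_node_map
  have key : ∀ s, φ s = s ∧ ψ s = s := fun s => by
    induction s with
    | nil => exact ⟨hφ0, hψ0⟩
    | cons i s ih =>
      obtain ⟨g, hg, hg'⟩ := hφc s
      obtain ⟨h, hh, hh'⟩ := hψc s
      rw [ih.1] at hg'
      rw [ih.2] at hh'
      have h1 : ∀ i, h (g i) = i := fun i => by
        have := hff' (nodePt (i :: s))
        rw [hφ, hψ, hg', hh'] at this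
        simpa using this
      have h2 : ∀ i, g i = i := fun i =>
        le_antisymm (hh.le_apply.trans (h1 i).le) hg.le_apply
      have h3 : h i = i := by
        conv_lhs => rw [← h2 i, h1]
      exact ⟨by rw [hg', h2], by rw [hh', h3]⟩
  refine ⟨fun a => ?_, fun k v L => ?_⟩
  · rcases a with (_ | _ | k) | s
    · exact hf.map_base_source.1
    · exact hf.map_base_source.2
    · exact hf.map_label k
    · rw [hφ, (key s).1]
  · obtain ⟨s, hs⟩ : ∃ s : List ℕ, s.map entryValue = L :=
      ⟨L.map fun v => Nat.pair (Nat.pair v 0) 0, by simp [entryValue, Function.comp_def]⟩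
    have h := hφl k (Nat.pair (Nat.pair v (k + 1)) 0 :: s)
    rw [(key _).1, hasLabel_cons, hasLabel_cons] at h
    simpa [entryValue, entryLabel, hs] using h

open Classical in
/-- A level-preserving map of lists which preserves membership in the sets of labelled lists lifts
to an embedding of the coding digraphs. Preservation of non-edges is achieved by letting the image
of a node declare a label only if the node carries it. -/
theorem exists_code_embedding {p : ℕ → ℕ → ℕ}
    (hp : ∀ k v L, S k (v :: L) → S' k (mapDepth p (v :: L))) :
    ∃ f, IsDigraphEmbedding (CodeEdge S) (CodeEdge S') f := by
  have hG : ∀ s : List ℕ, ∃ g : ℕ → ℕ, StrictMono g ∧ ∀ i,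
      entryValue (g i) = p s.length (entryValue i) ∧
      entryLabel (g i) = if ∃ k, HasLabel S k (i :: s) then entryLabel i else 0 := fun s =>
    Filter.extraction_forall_of_frequently fun i => frequently_entry _ _
  choose G hGm hG using hG
  obtain ⟨φ, φ_nil, φ_cons⟩ : ∃ φ : List ℕ → List ℕ,
      φ [] = [] ∧ ∀ i s, φ (i :: s) = G s i :: φ s :=
    ⟨fun s => List.rec [] (fun i s r => G s i :: r) s, rfl, fun _ _ => rfl⟩
  have φ_vals : ∀ s, (φ s).map entryValue = mapDepth p (s.map entryValue) := fun s => by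
    induction s with
    | nil => rw [φ_nil]; rfl
    | cons i s ih => rw [φ_cons, List.map_cons, ih, List.map_cons, mapDepth, (hG s i).1,
        List.length_map]
  have φ_inj : Function.Injective φ := fun s => by
    induction s with
    | nil =>
      intro t h
      cases t with
      | nil => rfl
      | cons j t => simp [φ_nil, φ_cons] at h
    | cons i s ih =>
      intro t h
      cases t with
      | nil => simp [φ_nil, φ_cons] at h
      | cons j t =>
        rw [φ_cons, φ_cons] at h
        obtain ⟨h1, h2⟩ := List.cons.inj h
        obtain rfl := ih h2
        rw [(hGm s).injective h1]
  have φ_edge : ∀ s t, NodeEdge s t ↔ NodeEdge (φ s) (φ t) := fun s t => by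
    constructor
    · intro h
      cases h with
      | parent i s => rw [φ_cons]; exact .parent _ _
      | sibling s hij => rw [φ_cons, φ_cons]; exact .sibling _ (hGm s hij)
    · intro h
      rcases s with _ | ⟨i, s⟩
      · rw [φ_nil] at h
        cases h
      rcases t with _ | ⟨j, t⟩
      · rw [φ_nil, φ_cons] at h
        have h1 : φ s = φ [] := by
          rw [φ_nil]
          generalize φ s = u at h
          cases h
          rfl
        rw [φ_inj h1]
        exact .parent _ _
      · rw [φ_cons i s, φ_cons j t, nodeEdge_cons_cons] at h
        rw [nodeEdge_cons_cons]
        rcases h with h | ⟨h1, h2⟩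
        · exact Or.inl (φ_inj (h.trans (φ_cons j t).symm))
        · obtain rfl := φ_inj h1
          exact Or.inr ⟨rfl, (hGm s).lt_iff_lt.1 h2⟩
  have φ_label : ∀ k s, HasLabel S k s ↔ HasLabel S' k (φ s) := fun k s => by
    rcases s with _ | ⟨i, s⟩
    · rw [φ_nil]
      constructor <;> intro h <;> cases h
    rw [φ_cons, hasLabel_cons, hasLabel_cons, (hG s i).2, ← φ_cons, φ_vals]
    constructor
    · intro h
      rw [if_pos ⟨k, hasLabel_cons.2 h⟩]
      exact ⟨h.1, hp _ _ _ h.2⟩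
    · rintro ⟨h, -⟩
      by_cases hk : ∃ k, HasLabel S k (i :: s)
      · rw [if_pos hk] at h
        obtain ⟨k', hk'⟩ := hk
        rw [hasLabel_cons] at hk'
        obtain rfl : k' = k := by
          have := hk'.1.symm.trans h
          omega
        exact hk'
      · rw [if_neg hk] at h
        omega
  refine ⟨Sum.map id φ, Function.injective_id.sumMap φ_inj, fun a b => ?_⟩
  constructor
  · intro h
    cases h with
    | base_source => exact .base_source
    | source_base => exact .source_base
    | source_label k => exact .source_label k
    | source_node s => exact .source_node _
    | base_node =>
      rw [Sum.map_inr, φ_nil]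
      exact .base_node
    | label_base => exact .label_base
    | label_label k => exact .label_label k
    | node_node h => exact .node_node ((φ_edge _ _).1 h)
    | label_node h => exact .label_node ((φ_label _ _).1 h)
  · rcases a with (_ | _ | k) | s <;> rcases b with (_ | _ | l) | t <;> intro h
    case inr.inr => exact .node_node ((φ_edge _ _).2 (codeEdge_node_node_iff.1 h))
    case inl.succ.succ.inr => exact .label_node ((φ_label _ _).2 (codeEdge_label_node_iff.1 h))
    case inl.zero.inr =>
      rcases codeEdge_of_base_iff.1 h with h | h
      · cases h
      · rw [φ_inj ((Sum.inr_injective h).trans φ_nil.symm)]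
        exact .base_node
    all_goals first | (cases h; done) | (cases h; constructor)

end Code

/-! ### Quandles from digraphs -/

open Classical in
/-- The operation on the double cover of the vertices of a digraph in which every point over `a`
exchanges the two points over `b` if there is an edge from `a` to `b`, and fixes them otherwise. -/
noncomputable def coverOp {V : Type*} (E : V → V → Prop) (a b : V × Bool) : V × Bool :=
  (b.1, xor b.2 (decide (E a.1 b.1)))

section Cover

variable {V W : Type*} {E : V → V → Prop} {E' : W → W → Prop}

theorem coverOp_fst (a b : V × Bool) : (coverOp E a b).1 = b.1 := rfl

theorem coverOp_of_edge {a b : V × Bool} (h : E a.1 b.1) : coverOp E a b = (b.1, !b.2) := by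
  simp [coverOp, h]

theorem coverOp_of_not_edge {a b : V × Bool} (h : ¬ E a.1 b.1) : coverOp E a b = b := by
  simp [coverOp, h]

theorem coverOp_ne_iff {a b : V × Bool} : coverOp E a b ≠ b ↔ E a.1 b.1 := by
  by_cases h : E a.1 b.1
  · simp [coverOp_of_edge h, h, Prod.ext_iff]
  · simp [coverOp_of_not_edge h, h]

theorem coverOp_coverOp (a b : V × Bool) : coverOp E a (coverOp E a b) = b := by
  by_cases h : E a.1 b.1
  · rw [coverOp_of_edge (by exact h), coverOp_of_edge h]
    simp
  · rw [coverOp_of_not_edge h, coverOp_of_not_edge h]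

theorem isQuandleOp_coverOp (hE : ∀ a, ¬ E a a) : IsQuandleOp (coverOp E) where
  self_distrib _ _ _ := Prod.ext rfl (Bool.xor_right_comm _ _ _)
  existsUnique x z :=
    ⟨coverOp E x z, coverOp_coverOp x z, fun y hy => by rw [← hy, coverOp_coverOp]⟩
  idem x := coverOp_of_not_edge (hE _)

theorem IsDigraphEmbedding.cover {f : V → W} (hf : IsDigraphEmbedding E E' f) :
    Function.Injective (Prod.map f id : V × Bool → W × Bool) ∧
      ∀ a b, Prod.map f id (coverOp E a b) =
        coverOp E' (Prod.map f (id : Bool → Bool) a) (Prod.map f id b) := by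
  refine ⟨hf.injective.prodMap Function.injective_id, fun a b => ?_⟩
  by_cases h : E a.1 b.1
  · have h' := (hf.map_iff _ _).1 h
    rw [coverOp_of_edge h, coverOp_of_edge (by exact h')]
    rfl
  · have h' := fun h' => h ((hf.map_iff _ _).2 h')
    rw [coverOp_of_not_edge h, coverOp_of_not_edge (by exact h')]

/-- Embeddings of double covers respect the fibres, because each fibre is moved by some point, and
hence they induce digraph embeddings. -/
theorem exists_isDigraphEmbedding_of_cover (hE : ∀ b, ∃ a, E a b) {g : V × Bool → W × Bool}
    (hg : Function.Injective g) (hg' : ∀ a b, g (coverOp E a b) = coverOp E' (g a) (g b)) :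
    ∃ f, IsDigraphEmbedding E E' f ∧ ∀ a, (g a).1 = f a.1 := by
  have h1 : ∀ b i, (g (b, i)).1 = (g (b, false)).1 := fun b i => by
    obtain ⟨a, ha⟩ := hE b
    cases i with
    | false => rfl
    | true =>
      have := hg' (a, false) (b, false)
      rw [coverOp_of_edge (by exact ha)] at this
      exact (congrArg Prod.fst this).trans (coverOp_fst _ _)
  refine ⟨fun b => (g (b, false)).1, ⟨fun b b' h => ?_, fun a b => ?_⟩, fun a => h1 a.1 a.2⟩
  · -- both points of the fibre are attained over `b`, and one of them over `b'`
    obtain ⟨i, hi⟩ : ∃ i, g (b, i) = g (b', false) := by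
      by_cases hi : (g (b, false)).2 = (g (b', false)).2
      · exact ⟨false, Prod.ext h hi⟩
      · have hne : (g (b, true)).2 ≠ (g (b, false)).2 := fun h2 => by
          have := hg (Prod.ext (h1 b true) h2)
          simp at this
        refine ⟨true, Prod.ext ((h1 b true).trans h) ?_⟩
        revert hi hne
        generalize (g (b, true)).2 = u
        generalize (g (b, false)).2 = v
        generalize (g (b', false)).2 = w
        revert u v w
        decide
    exact congrArg Prod.fst (hg hi)
  · rw [← coverOp_ne_iff (E := E) (a := (a, false)) (b := (b, false)), ← hg.ne_iff, hg',
      coverOp_ne_iff]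

/-- Flipping some of the fibres is an automorphism of the double cover. -/
theorem coverOp_flip (c : V → Bool) (a b : V × Bool) :
    coverOp E (a.1, xor a.2 (c a.1)) (b.1, xor b.2 (c b.1)) =
      ((coverOp E a b).1, xor (coverOp E a b).2 (c (coverOp E a b).1)) :=
  Prod.ext rfl (Bool.xor_right_comm _ _ _)

end Cover

/-- Transport of a quandle operation along a bijection. -/
theorem IsQuandleOp.conj {Q Q' : Type*} {op : Q → Q → Q} (h : IsQuandleOp op) (e : Q ≃ Q') :
    IsQuandleOp fun m n => e (op (e.symm m) (e.symm n)) where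
  self_distrib x y z := by
    simp only [Equiv.symm_apply_apply]
    exact congrArg e (h.self_distrib _ _ _)
  existsUnique x z := by
    obtain ⟨y, hy, hy'⟩ := h.existsUnique (e.symm x) (e.symm z)
    refine ⟨e y, by simp [hy], fun y' h' => ?_⟩
    rw [← hy' (e.symm y') (by rw [← h']; simp)]
    simp
  idem x := (congrArg e (h.idem _)).trans (e.apply_symm_apply x)

/-- An enumeration of the double cover of the vertices of the coding digraphs. -/
noncomputable def coverEquiv : CodeVertex × Bool ≃ ℕ :=
  (Denumerable.ofEncodableOfInfinite (CodeVertex × Bool)).eqv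

/-- The quandle on `ℕ` given by the double cover of a coding digraph. -/
noncomputable def codeQuandle (S : ℕ → List ℕ → Prop) : QuandleSpace :=
  ⟨fun m n => coverEquiv (coverOp (CodeEdge S) (coverEquiv.symm m) (coverEquiv.symm n)),
    (isQuandleOp_coverOp codeEdge_irrefl).conj coverEquiv⟩

theorem codeQuandle_apply (S : ℕ → List ℕ → Prop) (a b : CodeVertex × Bool) :
    (codeQuandle S).1 (coverEquiv a) (coverEquiv b) = coverEquiv (coverOp (CodeEdge S) a b) := by
  simp [codeQuandle]

theorem exists_isDigraphEmbedding_of_codeQuandle {S S' : ℕ → List ℕ → Prop} {g : ℕ → ℕ}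
    (hg : Function.Injective g)
    (hg' : ∀ m n, g ((codeQuandle S).1 m n) = (codeQuandle S').1 (g m) (g n)) :
    ∃ f, IsDigraphEmbedding (CodeEdge S) (CodeEdge S') f ∧
      ∀ a, (coverEquiv.symm (g (coverEquiv a))).1 = f a.1 := by
  refine exists_isDigraphEmbedding_of_cover (g := fun a => coverEquiv.symm (g (coverEquiv a)))
    exists_codeEdge (coverEquiv.symm.injective.comp (hg.comp coverEquiv.injective)) fun a b => ?_
  rw [← codeQuandle_apply, hg']
  simp [codeQuandle]

theorem quandleEmbeds_codeQuandle_iff {S S' : ℕ → List ℕ → Prop} :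
    QuandleEmbeds (codeQuandle S) (codeQuandle S') ↔
      ∃ f, IsDigraphEmbedding (CodeEdge S) (CodeEdge S') f := by
  constructor
  · rintro ⟨g, hg, hg'⟩
    obtain ⟨f, hf, -⟩ := exists_isDigraphEmbedding_of_codeQuandle hg hg'
    exact ⟨f, hf⟩
  · rintro ⟨f, hf⟩
    obtain ⟨h1, h2⟩ := hf.cover
    refine ⟨fun m => coverEquiv (Prod.map f id (coverEquiv.symm m)),
      coverEquiv.injective.comp (h1.comp coverEquiv.symm.injective), fun m n => ?_⟩
    rw [codeQuandle_apply, ← h2]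
    simp [codeQuandle]

/-- The labels of a tree are determined by the isomorphism type of its quandle, and the isomorphisms
between two such quandles preserve each fibre of the double cover. -/
theorem codeQuandle_iso {S S' : ℕ → List ℕ → Prop} (g : Equiv.Perm ℕ)
    (hg : ∀ m n, g ((codeQuandle S).1 m n) = (codeQuandle S').1 (g m) (g n)) :
    (∀ k v L, S k (v :: L) ↔ S' k (v :: L)) ∧
      ∀ a, (coverEquiv.symm (g (coverEquiv a))).1 = a.1 := by
  have hg2 : ∀ m n, g.symm ((codeQuandle S').1 m n) =
      (codeQuandle S).1 (g.symm m) (g.symm n) := fun m n => by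
    rw [Equiv.symm_apply_eq, hg]
    simp
  obtain ⟨f, hf, hfg⟩ := exists_isDigraphEmbedding_of_codeQuandle g.injective hg
  obtain ⟨f', hf', hfg'⟩ := exists_isDigraphEmbedding_of_codeQuandle g.symm.injective hg2
  have hff' : ∀ a, f' (f a) = a := fun a => by
    have h1 := hfg (a, false)
    have h2 := hfg' (coverEquiv.symm (g (coverEquiv (a, false))))
    rw [h1] at h2
    simpa using h2.symm
  obtain ⟨h1, h2⟩ := eq_id_of_code_iso hf hf' hff'
  exact ⟨h2, fun a => by rw [hfg, h1]⟩

/-! ### The saturation of a Borel family of coding quandles -/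

theorem measurable_apply_of_measurable {α β : Type*} [MeasurableSpace α] [MeasurableSpace β]
    {f : α → ℕ → β} {g : α → ℕ} (hf : Measurable f) (hg : Measurable g) :
    Measurable fun a => f a (g a) := by
  have h : Measurable fun p : (ℕ → β) × ℕ => p.1 p.2 :=
    measurable_from_prod_countable_left fun n => measurable_pi_apply n
  exact h.comp (hf.prodMk hg)

theorem measurableSet_codeEdge {Y : Type*} [MeasurableSpace Y] {S : Y → ℕ → List ℕ → Prop}
    (hS : ∀ k L, MeasurableSet {x | S x k L}) (a b : CodeVertex) :
    MeasurableSet {x | CodeEdge (S x) a b} := by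
  by_cases hab : ∃ k i s, a = labelPt k ∧ b = nodePt (i :: s)
  · obtain ⟨k, i, s, rfl, rfl⟩ := hab
    simp only [codeEdge_label_node_iff, hasLabel_cons]
    exact (MeasurableSet.const _).inter (hS _ _)
  · -- all other edges are independent of the set of labelled lists
    have key : ∀ S₁ S₂ : ℕ → List ℕ → Prop, CodeEdge S₁ a b → CodeEdge S₂ a b := by
      intro S₁ S₂ h
      cases h with
      | label_node h =>
        cases h with
        | mk s hi hS => exact absurd ⟨_, _, _, rfl, rfl⟩ hab
      | node_node h => exact .node_node h
      | _ => constructor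
    have : {x | CodeEdge (S x) a b} = {_x | CodeEdge (fun _ _ => True) a b} := by
      ext x
      exact ⟨key _ _, key _ _⟩
    rw [this]
    exact MeasurableSet.const _

theorem measurable_codeQuandle {Y : Type*} [MeasurableSpace Y] {S : Y → ℕ → List ℕ → Prop}
    (hS : ∀ k L, MeasurableSet {x | S x k L}) : Measurable fun x => codeQuandle (S x) := by
  classical
  refine Measurable.subtype_mk (measurable_pi_iff.2 fun m => measurable_pi_iff.2 fun n => ?_)
  generalize coverEquiv.symm m = a
  generalize coverEquiv.symm n = b
  have : (fun x => coverEquiv (coverOp (CodeEdge (S x)) a b)) =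
      fun x => if CodeEdge (S x) a.1 b.1 then coverEquiv (b.1, !b.2) else coverEquiv b := by
    funext x
    split_ifs with h
    · rw [coverOp_of_edge h]
    · rw [coverOp_of_not_edge h]
  rw [this]
  exact Measurable.ite (measurableSet_codeEdge hS _ _) measurable_const measurable_const

/-- Permutations of `ℕ`, paired with their inverses, which preserve the order within each fibre of
the double cover. Every permutation differs from exactly one of these by flips of fibres. -/
def fibreMonoPerms : Set ((ℕ → ℕ) × (ℕ → ℕ)) :=
  {p | (∀ n, p.2 (p.1 n) = n) ∧ (∀ n, p.1 (p.2 n) = n) ∧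
    ∀ v, p.1 (coverEquiv (v, false)) < p.1 (coverEquiv (v, true))}

theorem measurableSet_fibreMonoPerms : MeasurableSet fibreMonoPerms := by
  have h1 : ∀ n, Measurable fun p : (ℕ → ℕ) × (ℕ → ℕ) => p.1 n := fun n =>
    (measurable_pi_apply n).comp measurable_fst
  have h2 : ∀ n, Measurable fun p : (ℕ → ℕ) × (ℕ → ℕ) => p.2 n := fun n =>
    (measurable_pi_apply n).comp measurable_snd
  simp only [fibreMonoPerms, Set.ofPred_and, Set.ofPred_forall]
  refine (MeasurableSet.iInter fun n => ?_).inter ((MeasurableSet.iInter fun n => ?_).inter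
    (MeasurableSet.iInter fun v => measurableSet_lt (h1 _) (h1 _)))
  · exact measurableSet_eq_fun (measurable_apply_of_measurable measurable_snd (h1 n))
      measurable_const
  · exact measurableSet_eq_fun (measurable_apply_of_measurable measurable_fst (h2 n))
      measurable_const

instance : StandardBorelSpace fibreMonoPerms := measurableSet_fibreMonoPerms.standardBorel

/-- The permutation underlying an element of `fibreMonoPerms`. -/
def monoPerm (p : fibreMonoPerms) : Equiv.Perm ℕ :=
  ⟨p.1.1, p.1.2, p.2.1, p.2.2.1⟩

/-- The isomorphic copy of a coding quandle along a permutation. -/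
noncomputable def conjCodeQuandle {Y : Type*} (S : Y → ℕ → List ℕ → Prop)
    (u : Y × fibreMonoPerms) : QuandleSpace :=
  ⟨fun m n => (monoPerm u.2) ((codeQuandle (S u.1)).1 ((monoPerm u.2).symm m) ((monoPerm u.2).symm n)),
    (codeQuandle (S u.1)).2.conj (monoPerm u.2)⟩

theorem conjCodeQuandle_apply {Y : Type*} (S : Y → ℕ → List ℕ → Prop) (u : Y × fibreMonoPerms)
    (m n : ℕ) : (conjCodeQuandle S u).1 ((monoPerm u.2) m) ((monoPerm u.2) n) =
      (monoPerm u.2) ((codeQuandle (S u.1)).1 m n) := by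
  simp [conjCodeQuandle]

theorem measurable_conjCodeQuandle {Y : Type*} [MeasurableSpace Y] {S : Y → ℕ → List ℕ → Prop}
    (hS : ∀ k L, MeasurableSet {x | S x k L}) : Measurable (conjCodeQuandle S) := by
  refine Measurable.subtype_mk (measurable_pi_iff.2 fun m => measurable_pi_iff.2 fun n => ?_)
  have h1 : Measurable fun u : Y × fibreMonoPerms => u.2.1.1 :=
    measurable_fst.comp (measurable_subtype_coe.comp measurable_snd)
  have h2 : Measurable fun u : Y × fibreMonoPerms => u.2.1.2 :=
    measurable_snd.comp (measurable_subtype_coe.comp measurable_snd)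
  have h3 : Measurable fun u : Y × fibreMonoPerms => (codeQuandle (S u.1)).1 :=
    measurable_subtype_coe.comp ((measurable_codeQuandle hS).comp measurable_fst)
  have h4 : ∀ n, Measurable fun u : Y × fibreMonoPerms => u.2.1.2 n := fun n =>
    (measurable_pi_apply n).comp h2
  exact measurable_apply_of_measurable h1
    (measurable_apply_of_measurable (measurable_apply_of_measurable h3 (h4 m)) (h4 n))

theorem injective_conjCodeQuandle {Y : Type*} {S : Y → ℕ → List ℕ → Prop}
    (hS : ∀ x y, (∀ k v L, S x k (v :: L) ↔ S y k (v :: L)) → x = y) :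
    Function.Injective (conjCodeQuandle S) := by
  rintro ⟨x, p⟩ ⟨y, q⟩ h
  obtain ⟨h1, h2⟩ := codeQuandle_iso (S := S x) (S' := S y) ((monoPerm p).trans (monoPerm q).symm)
    fun m n => by
      have h1 := conjCodeQuandle_apply S (x, p) m n
      have h2 := conjCodeQuandle_apply S (y, q) ((monoPerm q).symm ((monoPerm p) m))
        ((monoPerm q).symm ((monoPerm p) n))
      rw [h] at h1
      simp only [Equiv.apply_symm_apply] at h2
      simp only [Equiv.trans_apply]
      rw [← h1, h2, Equiv.symm_apply_apply]
  obtain rfl := hS x y h1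
  have h3 : ∀ a : CodeVertex × Bool, ∃ j, (monoPerm p) (coverEquiv a) = (monoPerm q) (coverEquiv (a.1, j)) :=
    fun a => by
      refine ⟨(coverEquiv.symm ((monoPerm q).symm ((monoPerm p) (coverEquiv a)))).2, ?_⟩
      have := h2 a
      rw [Equiv.trans_apply] at this
      rw [← this]
      simp
  have h4 : ∀ a, (monoPerm p) (coverEquiv a) = (monoPerm q) (coverEquiv a) := by
    rintro ⟨v, i⟩
    have hp : (monoPerm p) (coverEquiv (v, false)) < (monoPerm p) (coverEquiv (v, true)) := p.2.2.2 v
    have hq : (monoPerm q) (coverEquiv (v, false)) < (monoPerm q) (coverEquiv (v, true)) := q.2.2.2 v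
    obtain ⟨j, hj⟩ := h3 (v, false)
    obtain ⟨k, hk⟩ := h3 (v, true)
    cases j <;> cases k <;> cases i <;> simp_all <;> omega
  have h5 : (monoPerm p) = (monoPerm q) := Equiv.ext fun n => by simpa using h4 (coverEquiv.symm n)
  have h6 : p = q := Subtype.ext (Prod.ext (congrArg (fun g : Equiv.Perm ℕ => (g : ℕ → ℕ)) h5)
    (congrArg (fun g : Equiv.Perm ℕ => (g.symm : ℕ → ℕ)) h5))
  rw [h6]

/-- Every isomorphic copy of a coding quandle is a copy along a permutation that is monotone on
fibres, since the fibres of the double cover can be flipped independently. -/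
theorem mem_range_conjCodeQuandle_iff {Y : Type*} {S : Y → ℕ → List ℕ → Prop} {q : QuandleSpace} :
    q ∈ Set.range (conjCodeQuandle S) ↔ ∃ x, QuandleIso (codeQuandle (S x)) q := by
  constructor
  · rintro ⟨u, rfl⟩
    exact ⟨u.1, (monoPerm u.2), fun m n => (conjCodeQuandle_apply S u m n).symm⟩
  · rintro ⟨x, g, hg⟩
    let c : CodeVertex → Bool := fun v =>
      decide (g (coverEquiv (v, true)) < g (coverEquiv (v, false)))
    let σ : Equiv.Perm (CodeVertex × Bool) :=
      Function.Involutive.toPerm (fun a => (a.1, xor a.2 (c a.1))) fun a => by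
        simp
    let σ' : Equiv.Perm ℕ := (coverEquiv.symm.trans σ).trans coverEquiv
    have hσ : ∀ m n, σ' ((codeQuandle (S x)).1 m n) = (codeQuandle (S x)).1 (σ' m) (σ' n) := by
      intro m n
      obtain ⟨a, rfl⟩ := coverEquiv.surjective m
      obtain ⟨b, rfl⟩ := coverEquiv.surjective n
      have h : ∀ a, σ' (coverEquiv a) = coverEquiv (σ a) := fun a => by simp [σ']
      rw [codeQuandle_apply, h, h, h, codeQuandle_apply]
      exact congrArg coverEquiv (coverOp_flip c a b).symm
    have hp : ((g ∘ σ' : ℕ → ℕ), (σ'.symm ∘ g.symm : ℕ → ℕ)) ∈ fibreMonoPerms := by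
      refine ⟨fun n => by simp, fun n => by simp, fun v => ?_⟩
      have hne : g (coverEquiv (v, true)) ≠ g (coverEquiv (v, false)) := fun h => by
        simpa using coverEquiv.injective (g.injective h)
      have h : ∀ i, σ' (coverEquiv (v, i)) = coverEquiv (v, xor i (c v)) := fun i => by
        simp only [σ', Equiv.trans_apply, Equiv.symm_apply_apply]
        rfl
      simp only [Function.comp_apply, h]
      by_cases hc : g (coverEquiv (v, true)) < g (coverEquiv (v, false))
      · simp [c, hc]
      · simpa [c, hc] using lt_of_le_of_ne (not_lt.1 hc) hne.symm
    refine ⟨(x, ⟨_, hp⟩), Subtype.ext (funext fun m => funext fun n => ?_)⟩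
    have h1 : ∀ k, monoPerm ⟨_, hp⟩ k = g (σ' k) := fun _ => rfl
    have h2 : ∀ k, (monoPerm ⟨_, hp⟩).symm k = σ'.symm (g.symm k) := fun _ => rfl
    simp only [conjCodeQuandle, h1, h2]
    rw [hσ, hg]
    simp

theorem measurableEmbedding_conjCodeQuandle {Y : Type*} [MeasurableSpace Y] [StandardBorelSpace Y]
    {S : Y → ℕ → List ℕ → Prop} (hS : ∀ k L, MeasurableSet {x | S x k L})
    (hS' : ∀ x y, (∀ k v L, S x k (v :: L) ↔ S y k (v :: L)) → x = y) :
    MeasurableEmbedding (conjCodeQuandle S) :=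
  (measurable_conjCodeQuandle hS).measurableEmbedding (injective_conjCodeQuandle hS')

/-! ### Embeddability and isomorphism of quandles -/

theorem quandleIso_equivalence : Equivalence QuandleIso where
  refl _ := ⟨Equiv.refl ℕ, fun _ _ => rfl⟩
  symm := by
    rintro q r ⟨g, hg⟩
    refine ⟨g.symm, fun x y => ?_⟩
    rw [Equiv.symm_apply_eq, hg]
    simp
  trans := by
    rintro q r s ⟨g, hg⟩ ⟨h, hh⟩
    exact ⟨g.trans h, fun x y => by simp [hg, hh]⟩

theorem QuandleIso.embeds {q r : QuandleSpace} (h : QuandleIso q r) : QuandleEmbeds q r :=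
  let ⟨g, hg⟩ := h
  ⟨g, g.injective, hg⟩

theorem QuandleEmbeds.trans {q r s : QuandleSpace} (h : QuandleEmbeds q r)
    (h' : QuandleEmbeds r s) : QuandleEmbeds q s := by
  obtain ⟨f, hf, hf'⟩ := h
  obtain ⟨g, hg, hg'⟩ := h'
  exact ⟨g ∘ f, hg.comp hf, fun x y => by simp [hf', hg']⟩

/-- The homomorphisms between two quandles form a Borel relation. -/
theorem measurableSet_quandleHom :
    MeasurableSet {p : (QuandleSpace × QuandleSpace) × (ℕ → ℕ) |
      ∀ x y, p.2 (p.1.1.1 x y) = p.1.2.1 (p.2 x) (p.2 y)} := by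
  have h1 : Measurable fun p : (QuandleSpace × QuandleSpace) × (ℕ → ℕ) => p.1.1.1 :=
    measurable_subtype_coe.comp (measurable_fst.comp measurable_fst)
  have h2 : Measurable fun p : (QuandleSpace × QuandleSpace) × (ℕ → ℕ) => p.1.2.1 :=
    measurable_subtype_coe.comp (measurable_snd.comp measurable_fst)
  have h3 : ∀ n, Measurable fun p : (QuandleSpace × QuandleSpace) × (ℕ → ℕ) => p.2 n :=
    fun n => (measurable_pi_apply n).comp measurable_snd
  simp only [Set.ofPred_forall]
  refine MeasurableSet.iInter fun x => MeasurableSet.iInter fun y => measurableSet_eq_fun ?_ ?_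
  · exact measurable_apply_of_measurable measurable_snd
      ((measurable_eval_of_measurable measurable_const measurable_const).comp h1)
  · exact measurable_apply_of_measurable (measurable_apply_of_measurable h2 (h3 x)) (h3 y)

theorem isAnalyticRel_quandleEmbeds : IsAnalyticRel QuandleEmbeds := by
  refine ⟨ℕ → ℕ, inferInstance, inferInstance, inferInstance, inferInstance,
    {p | Function.Injective p.2} ∩ {p | ∀ x y, p.2 (p.1.1.1 x y) = p.1.2.1 (p.2 x) (p.2 y)},
    MeasurableSet.inter ?_ measurableSet_quandleHom, rfl⟩
  have h : ∀ n, Measurable fun p : (QuandleSpace × QuandleSpace) × (ℕ → ℕ) => p.2 n :=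
    fun n => (measurable_pi_apply n).comp measurable_snd
  simp only [Function.Injective, Set.ofPred_forall]
  exact MeasurableSet.iInter fun x => MeasurableSet.iInter fun y =>
    (measurableSet_eq_fun (h x) (h y)).imp (MeasurableSet.const _)

theorem isAnalyticRel_quandleIso : IsAnalyticRel QuandleIso := by
  refine ⟨(ℕ → ℕ) × (ℕ → ℕ), inferInstance, inferInstance, inferInstance, inferInstance,
    {p | (∀ n, p.2.2 (p.2.1 n) = n) ∧ ∀ n, p.2.1 (p.2.2 n) = n} ∩
      (fun p => (p.1, p.2.1)) ⁻¹' {p | ∀ x y, p.2 (p.1.1.1 x y) = p.1.2.1 (p.2 x) (p.2 y)},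
    MeasurableSet.inter ?_ ((measurable_fst.prodMk (measurable_fst.comp measurable_snd))
      measurableSet_quandleHom), ?_⟩
  · have h1 : Measurable fun p : (QuandleSpace × QuandleSpace) × (ℕ → ℕ) × (ℕ → ℕ) => p.2.1 :=
      measurable_fst.comp measurable_snd
    have h2 : Measurable fun p : (QuandleSpace × QuandleSpace) × (ℕ → ℕ) × (ℕ → ℕ) => p.2.2 :=
      measurable_snd.comp measurable_snd
    simp only [Set.ofPred_and, Set.ofPred_forall]
    refine (MeasurableSet.iInter fun n => ?_).inter (MeasurableSet.iInter fun n => ?_)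
    · exact measurableSet_eq_fun (measurable_apply_of_measurable h2
        ((measurable_pi_apply n).comp h1)) measurable_const
    · exact measurableSet_eq_fun (measurable_apply_of_measurable h1
        ((measurable_pi_apply n).comp h2)) measurable_const
  · ext p
    constructor
    · rintro ⟨g, hg⟩
      exact ⟨(g, g.symm), ⟨g.symm_apply_apply, g.apply_symm_apply⟩, hg⟩
    · rintro ⟨z, ⟨h1, h2⟩, hz⟩
      exact ⟨⟨z.1, z.2, h1, h2⟩, hz⟩

/-! ### Reduction of an arbitrary analytic quasi-order -/

/-- The image of an analytic relation under a Borel map into the Cantor space is the projection of a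
closed set. -/
theorem exists_isClosed_of_isAnalyticRel {Y : Type*} [MeasurableSpace Y] [StandardBorelSpace Y]
    {R : Y → Y → Prop} (hR : IsAnalyticRel R) {e : Y → ℕ → Bool} (he : Measurable e) :
    ∃ F : Set (((ℕ → Bool) × (ℕ → Bool)) × (ℕ → ℕ)), IsClosed F ∧
      ∀ c d, (∃ x y, R x y ∧ e x = c ∧ e y = d) ↔ ∃ t, ((c, d), t) ∈ F := by
  obtain ⟨Z, _, _, _, _, C, hC, hRC⟩ := hR
  have hA : MeasureTheory.AnalyticSet ((fun p : (Y × Y) × Z => (e p.1.1, e p.1.2)) '' C) :=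
    hC.analyticSet_image ((he.comp (measurable_fst.comp measurable_fst)).prodMk
      (he.comp (measurable_snd.comp measurable_fst)))
  have h1 : ∀ c d, (∃ x y, R x y ∧ e x = c ∧ e y = d) ↔
      (c, d) ∈ (fun p : (Y × Y) × Z => (e p.1.1, e p.1.2)) '' C := fun c d => by
    have h2 : ∀ x y, R x y ↔ ∃ z, ((x, y), z) ∈ C := fun x y =>
      Set.ext_iff.1 hRC (x, y)
    constructor
    · rintro ⟨x, y, hxy, rfl, rfl⟩
      obtain ⟨z, hz⟩ := (h2 x y).1 hxy
      exact ⟨_, hz, rfl⟩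
    · rintro ⟨⟨⟨x, y⟩, z⟩, hz, h⟩
      exact ⟨x, y, (h2 x y).2 ⟨z, hz⟩, congrArg Prod.fst h, congrArg Prod.snd h⟩
  simp only [h1]
  rw [MeasureTheory.AnalyticSet] at hA
  rcases hA with hA | ⟨g, hg, hgA⟩
  · exact ⟨∅, isClosed_empty, fun c d => by simp [hA]⟩
  · refine ⟨{p | g p.2 = p.1}, isClosed_eq (hg.comp continuous_snd) continuous_fst, fun c d => ?_⟩
    rw [← hgA]
    rfl

/-- An embedding of the coding digraphs of `x` and `y` yields a branch witnessing that `x` and `y`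
are related: it is the image of a branch of nodes which have value zero and whose labels name
better and better approximations of `x`. -/
theorem eq_or_of_code_embedding {F : Set (((ℕ → Bool) × (ℕ → Bool)) × (ℕ → ℕ))} (hF : IsClosed F)
    {A : (ℕ → Bool) → (ℕ → Bool) → Prop} (hA : ∀ x y, A x y ↔ ∃ t, ((x, y), t) ∈ F)
    (htrans : ∀ x y w, A x y → A y w → A x w) {x y : ℕ → Bool} {f : CodeVertex → CodeVertex}
    (hf : IsDigraphEmbedding (CodeEdge (nodeLabels F x)) (CodeEdge (nodeLabels F y)) f) :
    x = y ∨ A x y := by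
  obtain ⟨φ, -, φ_nil, φ_cons, φ_label⟩ := hf.exists_node_map
  choose j hj using fun n => exists_denseSeq_eqUpTo n x
  -- the declared label is shifted by one for the digraph and by another one for the tree relation
  obtain ⟨N, N_zero, hN⟩ : ∃ N : ℕ → List ℕ, N 0 = [] ∧
      ∀ n, N (n + 1) = Nat.pair (Nat.pair 0 (j (n + 1) + 2)) 0 :: N n :=
    ⟨fun n => Nat.rec [] (fun n L => Nat.pair (Nat.pair 0 (j (n + 1) + 2)) 0 :: L) n, rfl,
      fun _ => rfl⟩
  have hlen : ∀ n, (N n).length = n := fun n => by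
    induction n with
    | zero => rw [N_zero]; rfl
    | succ n ih => rw [hN, List.length_cons, ih]
  choose G _ hG using φ_cons
  refine eq_or_of_nodeLabels hF hA htrans (L := fun n => (φ (N n)).map entryValue)
    (z := fun n => entryValue (G (N n) (Nat.pair (Nat.pair 0 (j (n + 1) + 2)) 0)))
    (by simp [N_zero, φ_nil]) (fun n => by simp only [hN, hG, List.map_cons]) hj fun n => ?_
  have h1 : HasLabel (nodeLabels F x) (j (n + 1) + 1) (N (n + 1)) := by
    rw [hN, hasLabel_cons, ← hN]
    refine ⟨by simp [entryLabel], TreeRel.of_eqUpTo _ ?_⟩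
    rw [List.length_map, hlen]
    exact (hj (n + 1)).symm
  have h2 := (φ_label _ _).1 h1
  rw [hN, hG, hasLabel_cons, ← hG, ← hN] at h2
  exact h2.2

theorem mainTheorem1 :
    IsInvariantlyUniversal.{u, 0} (X := QuandleSpace) QuandleEmbeds QuandleIso where
  quasiOrder := ⟨fun q => (quandleIso_equivalence.refl q).embeds, fun _ _ _ => QuandleEmbeds.trans,
    isAnalyticRel_quandleEmbeds⟩
  equivalence := quandleIso_equivalence
  analytic := isAnalyticRel_quandleIso
  subrelation := fun _ _ => QuandleIso.embeds
  universal := by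
    intro Y _ _ R hR
    obtain ⟨e, he, he'⟩ := MeasurableSpace.measurable_injection_nat_bool_of_countablySeparated Y
    obtain ⟨F, hF, hA⟩ := exists_isClosed_of_isAnalyticRel hR.analytic he
    let S : Y → ℕ → List ℕ → Prop := fun x => nodeLabels F (e x)
    have hS : ∀ k L, MeasurableSet {x | S x k L} := fun k L =>
      he (isOpen_nodeLabels F k L).measurableSet
    have hS' : ∀ x y, (∀ k v L, S x k (v :: L) ↔ S y k (v :: L)) → x = y := fun x y h =>
      he' (eq_of_nodeLabels fun a => h 0 a [])
    have hRA : ∀ x y, R x y ↔ e x = e y ∨ ∃ x' y', R x' y' ∧ e x' = e x ∧ e y' = e y := by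
      intro x y
      constructor
      · exact fun h => Or.inr ⟨x, y, h, rfl, rfl⟩
      · rintro (h | ⟨x', y', h, h1, h2⟩)
        · exact he' h ▸ hR.refl x
        · exact he' h1 ▸ he' h2 ▸ h
    have htrans : ∀ a b c, (∃ x y, R x y ∧ e x = a ∧ e y = b) → (∃ x y, R x y ∧ e x = b ∧ e y = c) →
        ∃ x y, R x y ∧ e x = a ∧ e y = c := by
      rintro a b c ⟨x, y, h, rfl, rfl⟩ ⟨y', w, h', h1, rfl⟩
      obtain rfl := he' h1
      exact ⟨x, w, hR.trans _ _ _ h h', rfl, rfl⟩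
    have hred : ∀ x y, R x y ↔ QuandleEmbeds (codeQuandle (S x)) (codeQuandle (S y)) := by
      intro x y
      rw [quandleEmbeds_codeQuandle_iff, hRA]
      constructor
      · intro h
        rw [hA] at h
        obtain ⟨p, hp⟩ := exists_mapDepth_nodeLabels h
        exact exists_code_embedding hp
      · rintro ⟨f, hf⟩
        exact eq_or_of_code_embedding hF hA htrans hf
    have hemb := measurableEmbedding_conjCodeQuandle hS hS'
    refine ⟨Set.range (conjCodeQuandle S), hemb.measurableSet_range, fun q r hqr hq => ?_, ?_, ?_⟩
    · rw [mem_range_conjCodeQuandle_iff] at hq ⊢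
      exact hq.imp fun x hx => quandleIso_equivalence.trans hx hqr
    · refine ⟨fun q => (hemb.equivRange.symm q).1,
        measurable_fst.comp hemb.equivRange.symm.measurable, fun q r => ?_⟩
      have hiso : ∀ q : Set.range (conjCodeQuandle S),
          QuandleIso (codeQuandle (S (hemb.equivRange.symm q).1)) q := fun q => by
        have h1 := congrArg Subtype.val (hemb.equivRange.apply_symm_apply q)
        rw [hemb.equivRange_apply] at h1
        rw [← h1]
        exact ⟨monoPerm _, fun m n => (conjCodeQuandle_apply S _ m n).symm⟩
      rw [hred]
      exact ⟨fun h => (hiso q).embeds.trans (h.trans (quandleIso_equivalence.symm (hiso r)).embeds),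
        fun h => (quandleIso_equivalence.symm (hiso q)).embeds.trans (h.trans (hiso r).embeds)⟩
    · refine ⟨fun x => ⟨codeQuandle (S x), mem_range_conjCodeQuandle_iff.2
        ⟨x, quandleIso_equivalence.refl _⟩⟩, (measurable_codeQuandle hS).subtype_mk, hred⟩
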